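/- Let $d\ge 1$ be fixed. For $n\in\mathbb N$, a unit vector $|\psi\rangle\in(\mathbb C^d)^{\otimes n}$ and a Hermitian operator $H$ on $(\mathbb C^d)^{\otimes n}$, write $$F_Q(|\psi\rangle,H)=4\big(\langle\psi|H^2|\psi\rangle-\langle\psi|H|\psi\rangle^2\big)$$ for the quantum Fisher information (QFI), and let $\max_{|\Phi\rangle:\,\mathrm{separable}}F_Q(|\Phi\rangle,H)$ be the maximum of $F_Q(|\Phi\rangle,H)$ over the product states $|\Phi\rangle=|\varphi_1\rangle\otimes\cdots\otimes|\varphi_n\rangle$ of unit vectors $|\varphi_i\rangle\in\mathbb C^d$. Let $k(n)$ be a sequence of natural numbers with $k(n)=o(n/\log n)$, and let $B_n>0$ be a sequence with $\log B_n=o(n)$ (for $d\ge2$: $B_n=d^{o(n)}$; for example a constant, or a power $B^{k(n)}$ of a constant). For each $n$ let $S_{LD}=S_{LD}(n)$ be the set consisting of 1. all linear Hamiltonians $H=h_1\otimes I\otimes\cdots\otimes I+\cdots+I\otimes\cdots\otimes I\otimes h_n$, where each $h_i=\sum_{j=1}^d\lambda_{i,j}|\phi_j\rangle_i\langle\phi_j|_i$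 is a Hermitian operator on $\mathbb C^d$ (with an orthonormal basis $\{|\phi_j\rangle_i\}_j$ of $\mathbb C^d$) and $\|h_i\|_\infty\le B_n$; and 2. all $k(n)$-body locally diagonalizable Hamiltonians $H=\sum_{S\subseteq\{1,\dots,n\},\,|S|\le k(n)}H_S$, where for some choice of orthonormal bases $\{|\phi_1\rangle_i,\dots,|\phi_d\rangle_i\}$ of $\mathbb C^d$ $(i=1,\dots,n)$, common to all $S$, $$H_S=\sum_{x\in\{1,\dots,d\}^S}a_{S,x}\Big(\bigotimes_{i\in S}|\phi_{x_i}\rangle_i\langle\phi_{x_i}|_i\Big)\otimes I,\qquad a_{S,x}\in\mathbb R,\quad \|H_S\|_\infty=\max_x|a_{S,x}|\le B_n .$$ Then for every constant $c>0$, $$\Pr_{|\psi\rangle\leftarrow(\mathbb C^d)^{\otimes n}}\Big(\sup_{H\in S_{LD}(n)}\Big(F_Q(|\psi\rangle,H)-\max_{|\Phi\rangle:\,\mathrm{separable}}F_Q(|\Phi\rangle,H)\Big)>c\Big)\longrightarrow 0\qquad(n\to\infty),$$ where $|\psi\rangle$ is Haar-random, i.e. uniformly distributed on the unit sphere of $(\mathbb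 C^d)^{\otimes n}$. -/

import Mathlib

open MeasureTheory Filter Topology Asymptotics Matrix

noncomputable section

namespace QuditQFI

/-- The Hilbert space `(ℂ^d)^{⊗ n}` of `n` qudits, in coordinates with respect to the
computational product basis `|x_1 ⋯ x_n⟩`, `x : Fin n → Fin d`. -/
abbrev NQudit (d n : ℕ) : Type := EuclideanSpace ℂ (Fin n → Fin d)

/-- Operators on `(ℂ^d)^{⊗ n}`, as matrices in the computational product basis. -/
abbrev Op (d n : ℕ) : Type := Matrix (Fin n → Fin d) (Fin n → Fin d) ℂ

/-- The product vector `φ_1 ⊗ ⋯ ⊗ φ_n`. -/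
def productVec {d n : ℕ} (φ : Fin n → EuclideanSpace ℂ (Fin d)) : NQudit d n :=
  WithLp.toLp 2 fun x => ∏ i, φ i (x i)

/-- The tensor product operator `M_1 ⊗ ⋯ ⊗ M_n`. -/
def tensorOp {d n : ℕ} (M : Fin n → Matrix (Fin d) (Fin d) ℂ) : Op d n :=
  Matrix.of fun x y => ∏ i, M i (x i) (y i)

/-- The rank-one operator `|v⟩⟨v|` on `ℂ^d`. -/
def ketbra {d : ℕ} (v : EuclideanSpace ℂ (Fin d)) : Matrix (Fin d) (Fin d) ℂ :=
  Matrix.of fun a b => v a * star (v b)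

/-- The expectation value `⟨ψ|H|ψ⟩` (the real part is taken only to have a real-valued
function; the quantity is real for Hermitian `H`). -/
def expVal {d n : ℕ} (ψ : NQudit d n) (H : Op d n) : ℝ :=
  (∑ x, ∑ y, star (ψ x) * H x y * ψ y).re

/-- The quantum Fisher information of the pure state `ψ` for the Hamiltonian `H`,
`F_Q(ψ, H) = 4 (⟨ψ|H²|ψ⟩ - ⟨ψ|H|ψ⟩²)`. -/
def qfi {d n : ℕ} (ψ : NQudit d n) (H : Op d n) : ℝ :=
  4 * (expVal ψ (H * H) - expVal ψ H ^ 2)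

/-- `n`-tuples of pure states (unit vectors) of single qudits. -/
abbrev LocalStates (d n : ℕ) : Type :=
  Fin n → Metric.sphere (0 : EuclideanSpace ℂ (Fin d)) 1

/-- The QFI of an optimal separable state: the maximum of `F_Q(Φ, H)` over all pure product
states `Φ = φ_1 ⊗ ⋯ ⊗ φ_n`. The supremum is attained, see `exists_qfi_eq_maxSepQFI`. -/
def maxSepQFI {d n : ℕ} (H : Op d n) : ℝ :=
  ⨆ φ : LocalStates d n, qfi (productVec fun i => (φ i : EuclideanSpace ℂ (Fin d))) H

theorem continuous_qfi_productVec {d n : ℕ} (H : Op d n) :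
    Continuous fun φ : LocalStates d n =>
      qfi (productVec fun i => (φ i : EuclideanSpace ℂ (Fin d))) H := by
  unfold qfi expVal productVec
  simp only
  fun_prop

/-- The supremum defining `maxSepQFI` is a maximum. -/
theorem exists_qfi_eq_maxSepQFI {d n : ℕ} (hd : 0 < d) (H : Op d n) :
    (∃ φ : LocalStates d n,
      qfi (productVec fun i => (φ i : EuclideanSpace ℂ (Fin d))) H = maxSepQFI H) ∧
    ∀ φ : LocalStates d n,
      qfi (productVec fun i => (φ i : EuclideanSpace ℂ (Fin d))) H ≤ maxSepQFI H := by
  have : Nonempty (Fin d) := ⟨⟨0, hd⟩⟩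
  have : Nonempty (Metric.sphere (0 : EuclideanSpace ℂ (Fin d)) 1) :=
    (NormedSpace.sphere_nonempty.2 zero_le_one).to_subtype
  have hcont := continuous_qfi_productVec (d := d) (n := n) H
  have hbdd : BddAbove (Set.range fun φ : LocalStates d n =>
      qfi (productVec fun i => (φ i : EuclideanSpace ℂ (Fin d))) H) :=
    (isCompact_range hcont).bddAbove
  refine ⟨?_, fun φ => le_ciSup hbdd φ⟩
  have := (isCompact_range hcont).sSup_mem (Set.range_nonempty _)
  exact this

/-- A product basis of `(ℂ^d)^{⊗ n}`: an orthonormal basis of `ℂ^d` for each qudit. -/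
abbrev ProductBasis (d n : ℕ) : Type :=
  Fin n → OrthonormalBasis (Fin d) ℂ (EuclideanSpace ℂ (Fin d))

/-- `H = h_1 ⊗ I ⊗ ⋯ ⊗ I + ⋯ + I ⊗ ⋯ ⊗ I ⊗ h_n`, where `h_i = ∑_j λ_{i,j} |φ_j⟩_i⟨φ_j|_i` is
a Hermitian operator on the `i`-th qudit with `‖h_i‖_∞ ≤ B`, i.e. `|λ_{i,j}| ≤ B`. -/
def IsLinear (d n : ℕ) (B : ℝ) (H : Op d n) : Prop :=
  ∃ (φ : ProductBasis d n) (l : Fin n → Fin d → ℝ),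
    (∀ i j, |l i j| ≤ B) ∧
    H = ∑ i, tensorOp (Function.update (fun _ => 1) i
          (∑ j, (l i j : ℂ) • ketbra (φ i j)))

/-- The operator `(⨂_{i ∈ S} |φ_{x_i}⟩_i⟨φ_{x_i}|_i) ⊗ I`, acting on the qudits in `S` only. -/
def localProj {d n : ℕ} (φ : ProductBasis d n) (S : Finset (Fin n)) (x : S → Fin d) : Op d n :=
  tensorOp fun i => if h : i ∈ S then ketbra (φ i (x ⟨i, h⟩)) else 1

/-- `k`-body locally diagonalizable Hamiltonians: `H = ∑_{|S| ≤ k} H_S`, where the interaction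
`H_S = ∑_x a_{S,x} (⨂_{i ∈ S} |φ_{x_i}⟩_i⟨φ_{x_i}|_i) ⊗ I` acts on the qudits in `S` only, all
`H_S` are diagonal in one product basis, and `‖H_S‖_∞ ≤ B`, i.e. `|a_{S,x}| ≤ B`. Products
`μ_S ⨂_{i ∈ S} h_i` with `h_i` diagonal in the `i`-th local basis are of this form. -/
def IsKBodyLD (d n k : ℕ) (B : ℝ) (H : Op d n) : Prop :=
  ∃ (φ : ProductBasis d n) (a : (S : Finset (Fin n)) → (S → Fin d) → ℝ),
    (∀ S x, |a S x| ≤ B) ∧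
    H = ∑ S ∈ (Finset.univ : Finset (Finset (Fin n))).filter (fun S => S.card ≤ k),
          ∑ x : S → Fin d, (a S x : ℂ) • localProj φ S x

/-- All linear Hamiltonians together with all `k`-body locally diagonalizable Hamiltonians on
`n` qudits, with local terms of operator norm at most `B`. -/
def hamiltonianSet (d n k : ℕ) (B : ℝ) : Set (Op d n) :=
  {H | IsLinear d n B H ∨ IsKBodyLD d n k B H}

/-- The law of a Haar-random `n`-qudit pure state: the uniform probability measure on the unit
sphere of `(ℂ^d)^{⊗ n}`. -/
def haarState (d n : ℕ) : Measure (Metric.sphere (0 : NQudit d n) 1) :=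
  ((volume : Measure (NQudit d n)).toSphere Set.univ)⁻¹ •
    (volume : Measure (NQudit d n)).toSphere

theorem isProbabilityMeasure_haarState {d n : ℕ} (hd : 0 < d) :
    IsProbabilityMeasure (haarState d n) := by
  have : Nonempty (Fin d) := ⟨⟨0, hd⟩⟩
  constructor
  rw [haarState, Measure.smul_apply, smul_eq_mul]
  refine ENNReal.inv_mul_cancel ?_ (measure_ne_top _ _)
  rw [Ne, Measure.measure_univ_eq_zero]
  exact Measure.toSphere_ne_zero _

end QuditQFI

end

/-! All Hamiltonians in the set that are diagonal in a given product basis can be compared with one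
product state: the tensor product Φ of the uniform superpositions of the local bases. Each local
projection has in Φ its maximally mixed expectation, and products of local projections in a common
basis are again local projections or zero. Hence H and H² have in Φ exactly their normalized traces
as expectations (`traceDev_uniformSuperposition`).

A Haar-random ψ nearly has the same expectations. Its fourth moments (`fourthMoment_eq`) give
variance at most ‖A‖₂²/(D(D+1)) for ⟨ψ|A|ψ⟩, with D = d^n. Chebyshev and a union bound over few-site
matrix units in the computational basis show that all small reduced states of ψ are almost maximally
mixed. This event does not mention H, so it handles the supremum over the continuum of local bases
without a net.

On that event `qfi_sub_maxSepQFI_le` bounds the advantage by the entrywise error ε times a factor of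
size exp(o(n)). Choosing ε so that the bound equals c leaves a failure probability exp(o(n))/d^n. -/

noncomputable section

namespace QuditQFI

/-! ### Symmetries of the uniform measure on the complex sphere -/

section Moments


section SphereInvariance

open scoped Pointwise

variable {E : Type*} [NormedAddCommGroup E] [InnerProductSpace ℝ E]

/-- The action of a linear isometry on the unit sphere. -/
def sphereMap (L : E ≃ₗᵢ[ℝ] E) (x : Metric.sphere (0 : E) 1) : Metric.sphere (0 : E) 1 :=
  ⟨L x, by simp⟩

theorem continuous_sphereMap (L : E ≃ₗᵢ[ℝ] E) : Continuous (sphereMap L) := by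
  unfold sphereMap
  fun_prop

variable [FiniteDimensional ℝ E] [MeasurableSpace E] [BorelSpace E]

/-- The spherical measure is defined by the volume of cones; the cone over a preimage is the
preimage of the cone, and a linear isometry preserves volume. -/
theorem measurePreserving_sphereMap (L : E ≃ₗᵢ[ℝ] E) :
    MeasurePreserving (sphereMap L) (volume : Measure E).toSphere
      (volume : Measure E).toSphere := by
  have hm : Measurable (sphereMap L) := (continuous_sphereMap L).measurable
  refine ⟨hm, Measure.ext fun s hs => ?_⟩
  rw [Measure.map_apply hm hs, Measure.toSphere_apply' _ hs, Measure.toSphere_apply' _ (hm hs)]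
  congr 1
  have key : Set.Ioo (0 : ℝ) 1 • ((↑) '' (sphereMap L ⁻¹' s) : Set E) =
      L ⁻¹' (Set.Ioo (0 : ℝ) 1 • ((↑) '' s : Set E)) := by
    ext v
    simp only [Set.mem_smul, Set.mem_image, Set.mem_preimage]
    constructor
    · rintro ⟨r, hr, _, ⟨x, hx, rfl⟩, rfl⟩
      exact ⟨r, hr, L x, ⟨sphereMap L x, hx, rfl⟩, by simp⟩
    · rintro ⟨r, hr, _, ⟨x, hx, rfl⟩, hv⟩
      refine ⟨r, hr, L.symm x, ⟨⟨L.symm x, by simp⟩, ?_, rfl⟩, ?_⟩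
      · have : sphereMap L ⟨L.symm x, by simp⟩ = x := Subtype.ext (by simp [sphereMap])
        simpa [this] using hx
      · apply L.injective
        rw [← hv]
        simp
  rw [key]
  exact L.measurePreserving.measure_preimage_emb L.toHomeomorph.measurableEmbedding _

theorem integral_toSphere_comp (L : E ≃ₗᵢ[ℝ] E) {F : Type*} [NormedAddCommGroup F]
    [NormedSpace ℝ F] [SecondCountableTopologyEither (Metric.sphere (0 : E) 1) F]
    {f : E → F} (hf : Continuous f) :
    ∫ x, f (L (x : E)) ∂(volume : Measure E).toSphere =
      ∫ x, f (x : E) ∂(volume : Measure E).toSphere := by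
  have h := measurePreserving_sphereMap L
  have := integral_map (μ := (volume : Measure E).toSphere) h.measurable.aemeasurable
    (f := fun x : Metric.sphere (0 : E) 1 => f x)
    (hf.comp continuous_subtype_val).aestronglyMeasurable
  rw [h.map_eq] at this
  exact this.symm

end SphereInvariance

variable {ι : Type*} [Fintype ι]

/-- The uniform probability measure on the unit sphere of `ℂ^ι`. -/
def uniformState (ι : Type*) [Fintype ι] :
    Measure (Metric.sphere (0 : EuclideanSpace ℂ ι) 1) :=
  ((volume : Measure (EuclideanSpace ℂ ι)).toSphere Set.univ)⁻¹ •
    (volume : Measure (EuclideanSpace ℂ ι)).toSphere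

instance isProbabilityMeasure_uniformState [Nonempty ι] :
    IsProbabilityMeasure (uniformState ι) := by
  constructor
  rw [uniformState, Measure.smul_apply, smul_eq_mul]
  refine ENNReal.inv_mul_cancel ?_ (measure_ne_top _ _)
  rw [Ne, Measure.measure_univ_eq_zero]
  exact Measure.toSphere_ne_zero _

theorem integral_uniformState_comp (L : EuclideanSpace ℂ ι ≃ₗᵢ[ℝ] EuclideanSpace ℂ ι)
    {F : Type*} [NormedAddCommGroup F] [NormedSpace ℝ F]
    {f : EuclideanSpace ℂ ι → F} (hf : Continuous f) :
    ∫ ψ, f (L (ψ : EuclideanSpace ℂ ι)) ∂uniformState ι =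
      ∫ ψ, f (ψ : EuclideanSpace ℂ ι) ∂uniformState ι := by
  simp only [uniformState, integral_smul_measure, integral_toSphere_comp L hf]

theorem integrable_uniformState [Nonempty ι] {F : Type*} [NormedAddCommGroup F]
    {f : EuclideanSpace ℂ ι → F} (hf : Continuous f) :
    Integrable (fun ψ : Metric.sphere (0 : EuclideanSpace ℂ ι) 1 => f ψ) (uniformState ι) := by
  rw [← integrableOn_univ]
  exact (hf.comp continuous_subtype_val).continuousOn.integrableOn_compact isCompact_univ

variable [DecidableEq ι]

/-- Multiplication of one coordinate by `i`. -/
def phaseMap (t : ι) : EuclideanSpace ℂ ι ≃ₗᵢ[ℝ] EuclideanSpace ℂ ι :=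
  LinearIsometryEquiv.piLpCongrRight 2 fun s =>
    if s = t then rotation ⟨Complex.I, by simp [Submonoid.unitSphere]⟩
    else LinearIsometryEquiv.refl ℝ ℂ

theorem phaseMap_apply (t : ι) (ψ : EuclideanSpace ℂ ι) (s : ι) :
    phaseMap t ψ s = if s = t then Complex.I * ψ s else ψ s := by
  unfold phaseMap
  by_cases h : s = t
  · simp [h]
    rfl
  · simp [h]

/-- The fourth moment `E[conj ψ_x ψ_y ψ_z conj ψ_w]` of a Haar-random state. -/
def fourthMoment (x y z w : ι) : ℂ :=
  ∫ ψ, star ((ψ : EuclideanSpace ℂ ι) x) * (ψ : EuclideanSpace ℂ ι) y *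
    ((ψ : EuclideanSpace ℂ ι) z * star ((ψ : EuclideanSpace ℂ ι) w)) ∂uniformState ι

/-- The factor by which `phaseMap t` multiplies the coordinate `s`. -/
def phaseFactor (t s : ι) : ℂ := if s = t then Complex.I else 1

theorem fourthMoment_phase (t x y z w : ι) :
    fourthMoment x y z w = star (phaseFactor t x) * phaseFactor t y *
      (phaseFactor t z * star (phaseFactor t w)) * fourthMoment x y z w := by
  have h := integral_uniformState_comp (phaseMap t)
    (f := fun ψ : EuclideanSpace ℂ ι => star (ψ x) * ψ y * (ψ z * star (ψ w))) (by fun_prop)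
  have e : ∀ (ψ : EuclideanSpace ℂ ι) s, phaseMap t ψ s = phaseFactor t s * ψ s := by
    intro ψ s
    rw [phaseMap_apply, phaseFactor]
    split_ifs <;> simp
  unfold fourthMoment
  rw [← integral_const_mul, ← h]
  refine integral_congr_ae (Eventually.of_forall fun ψ => ?_)
  simp only [e, star_mul']
  ring

/-- Unless conjugated and unconjugated indices pair off, some coordinate can be multiplied by i so
that the integrand picks up a factor -i or -1; invariance then forces the moment to vanish. -/
theorem fourthMoment_eq_zero {x y z w : ι} (h₁ : ¬(x = y ∧ z = w)) (h₂ : ¬(x = z ∧ y = w)) :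
    fourthMoment x y z w = 0 := by
  have aux : ∀ c : ℂ, fourthMoment x y z w = c * fourthMoment x y z w → c ≠ 1 →
      fourthMoment x y z w = 0 := by
    intro c hc h1
    by_contra h0
    exact h1 (mul_right_cancel₀ h0 (by rw [one_mul]; exact hc.symm))
  have hI : (-Complex.I) ≠ 1 := by intro h; simpa using congrArg Complex.im h
  have hI' : Complex.I ≠ 1 := by intro h; simpa using congrArg Complex.im h
  have hm : (-1 : ℂ) ≠ 1 := by norm_num
  by_cases hxy : x = y
  · subst hxy
    have hzw : z ≠ w := fun h => h₁ ⟨rfl, h⟩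
    refine aux _ (fourthMoment_phase w x x z w) ?_
    unfold phaseFactor
    by_cases hxw : x = w <;> simp [hxw, hzw, hI]
  · by_cases hxz : x = z
    · subst hxz
      have hyw : y ≠ w := fun h => h₂ ⟨rfl, h⟩
      refine aux _ (fourthMoment_phase w x y x w) ?_
      unfold phaseFactor
      by_cases hxw : x = w <;> simp [hxw, hyw, hI]
    · refine aux _ (fourthMoment_phase x x y z w) ?_
      unfold phaseFactor
      by_cases hwx : w = x <;> simp [hwx, Ne.symm hxy, Ne.symm hxz, hI, hm]

/-- The complex reflection fixing `e_x + c e_y` and negating its orthogonal complement. -/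
def pairReflection (x y : ι) (c : ℝ) : EuclideanSpace ℂ ι ≃ₗᵢ[ℂ] EuclideanSpace ℂ ι :=
  (ℂ ∙ (EuclideanSpace.single x (1 : ℂ) + EuclideanSpace.single y (c : ℂ))).reflection

theorem pairReflection_apply {x y : ι} (hxy : x ≠ y) (c : ℝ) (ψ : EuclideanSpace ℂ ι) :
    pairReflection x y c ψ x =
      (((1 - c ^ 2) / (1 + c ^ 2) : ℝ) : ℂ) * ψ x + ((2 * c / (1 + c ^ 2) : ℝ) : ℂ) * ψ y := by
  have hn : ‖(EuclideanSpace.single x (1 : ℂ) + EuclideanSpace.single y (c : ℂ) :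
      EuclideanSpace ℂ ι)‖ ^ 2 = 1 + c ^ 2 := by
    rw [EuclideanSpace.norm_sq_eq, ← Finset.add_sum_erase _ _ (Finset.mem_univ x),
      ← Finset.add_sum_erase _ _ (Finset.mem_erase.2 ⟨hxy.symm, Finset.mem_univ y⟩),
      Finset.sum_eq_zero]
    · simp [hxy, hxy.symm]
    · intro t ht
      simp only [Finset.mem_erase] at ht
      simp [ht.1, ht.2.1]
  have h0 : (1 + (c : ℂ) ^ 2) ≠ 0 := by
    have : (1 + c ^ 2 : ℝ) ≠ 0 := by positivity
    exact_mod_cast this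
  unfold pairReflection
  rw [Submodule.reflection_singleton_apply]
  have hn' : ((‖(EuclideanSpace.single x (1 : ℂ) + EuclideanSpace.single y (c : ℂ) :
      EuclideanSpace ℂ ι)‖ : ℂ)) ^ 2 = 1 + (c : ℂ) ^ 2 := by
    exact_mod_cast congrArg (fun r : ℝ => (r : ℂ)) hn
  simp only [Complex.coe_algebraMap, inner_add_left, EuclideanSpace.inner_single_left]
  erw [hn']
  simp [hxy]
  field_simp
  ring

end Moments

/-! ### Values of the fourth moments, and the variance of a quadratic form -/

section TraceDeviation


variable {ι : Type*} [Fintype ι]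

/-- A complex-linear isometry is a real-linear one. -/
def realIsometry (L : EuclideanSpace ℂ ι ≃ₗᵢ[ℂ] EuclideanSpace ℂ ι) :
    EuclideanSpace ℂ ι ≃ₗᵢ[ℝ] EuclideanSpace ℂ ι where
  toLinearEquiv := L.toLinearEquiv.restrictScalars ℝ
  norm_map' := L.norm_map

/-- The index map `s` lets the same expansion serve sums over two chosen coordinates and sums over
all of `ι`. -/
theorem integral_quartic [Nonempty ι] {κ : Type*} [Fintype κ] (s : κ → ι)
    (c : κ → κ → κ → κ → ℂ) :
    ∫ ψ, (∑ x, ∑ y, ∑ z, ∑ w, c x y z w * (star ((ψ : EuclideanSpace ℂ ι) (s x)) *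
      (ψ : EuclideanSpace ℂ ι) (s y) * ((ψ : EuclideanSpace ℂ ι) (s z) *
        star ((ψ : EuclideanSpace ℂ ι) (s w))))) ∂uniformState ι =
    ∑ x, ∑ y, ∑ z, ∑ w, c x y z w * fourthMoment (s x) (s y) (s z) (s w) := by
  have hi : ∀ f : EuclideanSpace ℂ ι → ℂ, Continuous f →
      Integrable (fun ψ : Metric.sphere (0 : EuclideanSpace ℂ ι) 1 => f ψ) (uniformState ι) :=
    fun f hf => integrable_uniformState hf
  rw [integral_finsetSum _ fun x _ => hi (fun ψ => ∑ y, ∑ z, ∑ w, c x y z w *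
    (star (ψ (s x)) * ψ (s y) * (ψ (s z) * star (ψ (s w))))) (by fun_prop)]
  refine Finset.sum_congr rfl fun x _ => ?_
  rw [integral_finsetSum _ fun y _ => hi (fun ψ => ∑ z, ∑ w, c x y z w *
    (star (ψ (s x)) * ψ (s y) * (ψ (s z) * star (ψ (s w))))) (by fun_prop)]
  refine Finset.sum_congr rfl fun y _ => ?_
  rw [integral_finsetSum _ fun z _ => hi (fun ψ => ∑ w, c x y z w *
    (star (ψ (s x)) * ψ (s y) * (ψ (s z) * star (ψ (s w))))) (by fun_prop)]
  refine Finset.sum_congr rfl fun z _ => ?_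
  rw [integral_finsetSum _ fun w _ => hi (fun ψ => c x y z w *
    (star (ψ (s x)) * ψ (s y) * (ψ (s z) * star (ψ (s w))))) (by fun_prop)]
  refine Finset.sum_congr rfl fun w _ => ?_
  rw [integral_const_mul, fourthMoment]

theorem fourthMoment_swap (x y : ι) :
    fourthMoment x y x y = fourthMoment x x y y := by
  unfold fourthMoment
  refine integral_congr_ae (Eventually.of_forall fun ψ => ?_)
  simp only
  ring

theorem fourthMoment_comm (x y : ι) :
    fourthMoment x x y y = fourthMoment y y x x := by
  unfold fourthMoment
  refine integral_congr_ae (Eventually.of_forall fun ψ => ?_)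
  simp only
  ring

variable [DecidableEq ι]

/-- Invariance under `pairReflection` replaces ψ_x by pψ_x + qψ_y. Of the 16 terms in the expansion
of its fourth absolute power, only the two pure ones and four mixed ones, all equal, survive. -/
theorem fourthMoment_rotate {x y : ι} (hxy : x ≠ y) (c : ℝ) :
    fourthMoment x x x x =
      ((((1 - c ^ 2) / (1 + c ^ 2)) ^ 4 : ℝ) : ℂ) * fourthMoment x x x x +
      (((2 * c / (1 + c ^ 2)) ^ 4 : ℝ) : ℂ) * fourthMoment y y y y +
      ((4 * ((1 - c ^ 2) / (1 + c ^ 2)) ^ 2 * (2 * c / (1 + c ^ 2)) ^ 2 : ℝ) : ℂ) *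
        fourthMoment x x y y := by
  have : Nonempty ι := ⟨x⟩
  set p : ℝ := (1 - c ^ 2) / (1 + c ^ 2)
  set q : ℝ := 2 * c / (1 + c ^ 2)
  have h := integral_uniformState_comp (realIsometry (pairReflection x y c))
    (f := fun ψ : EuclideanSpace ℂ ι => star (ψ x) * ψ x * (ψ x * star (ψ x))) (by fun_prop)
  let v : Fin 2 → ℂ := ![(p : ℂ), (q : ℂ)]
  let s : Fin 2 → ι := ![x, y]
  have e : ∀ ψ : EuclideanSpace ℂ ι, realIsometry (pairReflection x y c) ψ x =
      (p : ℂ) * ψ x + (q : ℂ) * ψ y := fun ψ => pairReflection_apply hxy c ψ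
  have h2 := integral_quartic s (fun i j k l => v i * v j * (v k * v l))
  have h3 : fourthMoment x x x x = ∑ i, ∑ j, ∑ k, ∑ l, v i * v j * (v k * v l) *
      fourthMoment (s i) (s j) (s k) (s l) := by
    rw [← h2]
    rw [fourthMoment, ← h]
    refine integral_congr_ae (Eventually.of_forall fun ψ => ?_)
    simp only [e, Fin.sum_univ_two, v, s, star_add, star_mul']
    simp
    ring
  have z : ∀ a b c d : ι, ¬(a = b ∧ c = d) → ¬(a = c ∧ b = d) → fourthMoment a b c d = 0 :=
    fun a b c d => fourthMoment_eq_zero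
  refine h3.trans ?_
  simp only [Fin.sum_univ_two, v, s, Matrix.cons_val_zero, Matrix.cons_val_one]
  simp only [z x x x y (by simp [hxy]) (by simp [hxy]), z x x y x (by simp [hxy.symm]) (by simp [hxy]),
    z x y x x (by simp [hxy]) (by simp [hxy.symm]), z y x x x (by simp [hxy.symm]) (by simp [hxy.symm]),
    z x y y x (by simp [hxy]) (by simp [hxy]), z y x x y (by simp [hxy.symm]) (by simp [hxy.symm]),
    z y y y x (by simp [hxy.symm]) (by simp [hxy.symm]), z y y x y (by simp [hxy]) (by simp [hxy.symm]),
    z y x y y (by simp [hxy.symm]) (by simp [hxy]), z x y y y (by simp [hxy]) (by simp [hxy]),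
    fourthMoment_swap x y, fourthMoment_swap y x, fourthMoment_comm y x]
  push_cast
  ring

theorem fourthMoment_diag_eq (x y : ι) : fourthMoment x x x x = fourthMoment y y y y := by
  by_cases hxy : x = y
  · rw [hxy]
  -- At c = 1 one has p = 0 and q = 1, so the reflection sends ψ_y to position x.
  have := fourthMoment_rotate hxy 1
  norm_num at this
  exact this

theorem fourthMoment_diag_eq_two_mul {x y : ι} (hxy : x ≠ y) :
    fourthMoment x x x x = 2 * fourthMoment x x y y := by
  -- At c = 2 one has p = -3/5 and q = 4/5, so p⁴ + q⁴ = 337/625 and 4p²q² = 576/625.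
  have := fourthMoment_rotate hxy 2
  rw [← fourthMoment_diag_eq x y] at this
  norm_num at this
  linear_combination (625 / 288 : ℂ) * this

omit [DecidableEq ι] in
theorem sum_star_mul_self (ψ : Metric.sphere (0 : EuclideanSpace ℂ ι) 1) :
    ∑ x, star ((ψ : EuclideanSpace ℂ ι) x) * (ψ : EuclideanSpace ℂ ι) x = 1 := by
  have h : ‖(ψ : EuclideanSpace ℂ ι)‖ ^ 2 = 1 := by simp
  rw [EuclideanSpace.norm_sq_eq] at h
  have h' := congrArg (fun r : ℝ => (r : ℂ)) h
  push_cast at h'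
  rw [← h']
  exact Finset.sum_congr rfl fun x _ => Complex.conj_mul' _

/-- The square of the normalization ∑|ψ_x|² = 1; this fixes the one constant that symmetry leaves
free. -/
theorem sum_fourthMoment [Nonempty ι] : ∑ x : ι, ∑ z : ι, fourthMoment x x z z = 1 := by
  have h := integral_quartic (id : ι → ι) (fun x y z w => if y = x then (if w = z then 1 else 0) else 0)
  have h1 : ∀ ψ : Metric.sphere (0 : EuclideanSpace ℂ ι) 1,
      (∑ x, ∑ z, (star ((ψ : EuclideanSpace ℂ ι) x) * (ψ : EuclideanSpace ℂ ι) x *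
        ((ψ : EuclideanSpace ℂ ι) z * star ((ψ : EuclideanSpace ℂ ι) z)))) = 1 := by
    intro ψ
    simp only [← Finset.mul_sum, ← Finset.sum_mul]
    rw [sum_star_mul_self, one_mul]
    rw [← sum_star_mul_self ψ]
    exact Finset.sum_congr rfl fun x _ => mul_comm _ _
  simp only [id, ite_mul, one_mul, zero_mul, Finset.sum_ite_eq', Finset.mem_univ, if_true,
    Finset.sum_ite_irrel, Finset.sum_const_zero, h1] at h
  rw [← h]
  simp

/-- The fourth moments of a Haar-random state. -/
theorem fourthMoment_eq [Nonempty ι] (x y z w : ι) :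
    fourthMoment x y z w = (1 / (Fintype.card ι * (Fintype.card ι + 1) : ℂ)) *
      ((if x = y ∧ z = w then 1 else 0) + if x = z ∧ y = w then 1 else 0) := by
  set D : ℂ := (Fintype.card ι : ℂ) with hDdef
  have hD : D ≠ 0 := by simp [D]
  have hD1 : D + 1 ≠ 0 := by
    exact Nat.cast_add_one_ne_zero _
  obtain ⟨o⟩ := ‹Nonempty ι›
  set α := fourthMoment o o o o
  have hα : ∀ x z : ι, fourthMoment x x z z = α / 2 * (1 + if x = z then 1 else 0) := by
    intro x z
    by_cases h : x = z
    · subst h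
      rw [fourthMoment_diag_eq x o]
      simp only [if_true]
      ring
    · rw [if_neg h]
      have := fourthMoment_diag_eq_two_mul h
      rw [fourthMoment_diag_eq x o] at this
      linear_combination (-1 / 2 : ℂ) * this
  have hs := sum_fourthMoment (ι := ι)
  simp only [hα, ← Finset.mul_sum, Finset.sum_add_distrib, Finset.sum_ite_eq, Finset.mem_univ,
    if_true, Finset.sum_const, Finset.card_univ, nsmul_eq_mul, mul_one, ← hDdef] at hs
  have hβ : α / 2 = 1 / (D * (D + 1)) := by
    rw [eq_div_iff (mul_ne_zero hD hD1)]
    linear_combination hs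
  rw [← hβ]
  by_cases h₁ : x = y ∧ z = w
  · obtain ⟨rfl, rfl⟩ := h₁
    rw [hα]
    simp
  · by_cases h₂ : x = z ∧ y = w
    · obtain ⟨rfl, rfl⟩ := h₂
      rw [fourthMoment_swap, hα]
      have : x ≠ y := fun h => h₁ ⟨h, h⟩
      simp [this]
    · rw [fourthMoment_eq_zero h₁ h₂]
      simp [h₁, h₂]

/-- The expectation value `⟨ψ|A|ψ⟩` as a complex number. -/
def cexpVal (ψ : EuclideanSpace ℂ ι) (A : Matrix ι ι ℂ) : ℂ :=
  ∑ x, ∑ y, star (ψ x) * A x y * ψ y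

/-- The deviation of `⟨ψ|A|ψ⟩` from the normalized trace of `A`. -/
def traceDev (ψ : EuclideanSpace ℂ ι) (A : Matrix ι ι ℂ) : ℂ :=
  cexpVal ψ A - A.trace / Fintype.card ι

omit [DecidableEq ι] in
theorem continuous_traceDev (A : Matrix ι ι ℂ) :
    Continuous fun ψ : EuclideanSpace ℂ ι => traceDev ψ A := by
  unfold traceDev cexpVal
  fun_prop

theorem integral_cexpVal_mul_star [Nonempty ι] (A : Matrix ι ι ℂ) :
    ∫ ψ, cexpVal (ψ : EuclideanSpace ℂ ι) A * star (cexpVal (ψ : EuclideanSpace ℂ ι) A)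
      ∂uniformState ι = (1 / (Fintype.card ι * (Fintype.card ι + 1) : ℂ)) *
        (A.trace * star A.trace + ∑ x, ∑ y, A x y * star (A x y)) := by
  have h := integral_quartic (id : ι → ι) (fun x y z w => A x y * star (A z w))
  have e : ∀ ψ : EuclideanSpace ℂ ι, cexpVal ψ A * star (cexpVal ψ A) =
      ∑ x, ∑ y, ∑ z, ∑ w, A x y * star (A z w) *
        (star (ψ x) * ψ y * (ψ z * star (ψ w))) := by
    intro ψ
    unfold cexpVal
    simp only [Finset.sum_mul]
    simp only [star_sum, Finset.mul_sum]
    refine Finset.sum_congr rfl fun x _ => Finset.sum_congr rfl fun y _ =>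
      Finset.sum_congr rfl fun z _ => Finset.sum_congr rfl fun w _ => ?_
    simp only [star_mul', star_star]
    ring
  simp only [e]
  simp only [id] at h
  rw [h]
  set β : ℂ := 1 / (Fintype.card ι * (Fintype.card ι + 1) : ℂ) with hβ
  have e2 : ∀ x y z w : ι, A x y * star (A z w) * fourthMoment x y z w =
      (if y = x then if w = z then β * (A x x * star (A z z)) else 0 else 0) +
        if z = x then if w = y then β * (A x y * star (A x y)) else 0 else 0 := by
    intro x y z w
    have p₁ : A x y * star (A z w) * (β * if x = y ∧ z = w then 1 else 0) =
        if y = x then if w = z then β * (A x x * star (A z z)) else 0 else 0 := by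
      by_cases h1 : x = y
      · subst h1
        by_cases h2 : z = w
        · subst h2
          simp only [and_self, if_true]
          ring
        · simp [h2, Ne.symm h2]
      · simp [h1, Ne.symm h1]
    have p₂ : A x y * star (A z w) * (β * if x = z ∧ y = w then 1 else 0) =
        if z = x then if w = y then β * (A x y * star (A x y)) else 0 else 0 := by
      by_cases h1 : x = z
      · subst h1
        by_cases h2 : y = w
        · subst h2
          simp only [and_self, if_true]
          ring
        · simp [h2, Ne.symm h2]
      · simp [h1, Ne.symm h1]
    rw [fourthMoment_eq, ← hβ, mul_add, mul_add, p₁, p₂]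
  simp only [e2, Finset.sum_add_distrib, Finset.sum_ite_eq', Finset.sum_ite_irrel,
    Finset.mem_univ, if_true, Finset.sum_const_zero, ← Finset.mul_sum, Matrix.trace, Matrix.diag,
    star_sum, Finset.sum_mul_sum, mul_add]

/-- On unit vectors the deviation is the quadratic form of the traceless part of `A`, whose second
moment is its squared Hilbert-Schmidt norm over D(D+1). Removing the trace only lowers that norm. -/
theorem integral_norm_traceDev_sq_le [Nonempty ι] (A : Matrix ι ι ℂ) :
    ∫ ψ, ‖traceDev (ψ : EuclideanSpace ℂ ι) A‖ ^ 2 ∂uniformState ι ≤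
      (∑ x, ∑ y, ‖A x y‖ ^ 2) / (Fintype.card ι * (Fintype.card ι + 1)) := by
  have hD : (Fintype.card ι : ℂ) ≠ 0 := by simp
  set t : ℂ := A.trace / Fintype.card ι with ht
  set A₀ : Matrix ι ι ℂ := A - t • 1 with hA₀
  have hdev : ∀ ψ : Metric.sphere (0 : EuclideanSpace ℂ ι) 1,
      traceDev (ψ : EuclideanSpace ℂ ι) A = cexpVal (ψ : EuclideanSpace ℂ ι) A₀ := by
    intro ψ
    have e : ∀ x y, star ((ψ : EuclideanSpace ℂ ι) x) * A₀ x y * (ψ : EuclideanSpace ℂ ι) y =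
        star ((ψ : EuclideanSpace ℂ ι) x) * A x y * (ψ : EuclideanSpace ℂ ι) y -
          if x = y then t * (star ((ψ : EuclideanSpace ℂ ι) x) * (ψ : EuclideanSpace ℂ ι) x)
          else 0 := by
      intro x y
      by_cases hxy : x = y
      · subst hxy
        simp [hA₀]
        ring
      · simp [hA₀, hxy]
    simp only [traceDev, cexpVal, e, Finset.sum_sub_distrib, Finset.sum_ite_eq, Finset.mem_univ,
      if_true, ← Finset.mul_sum, sum_star_mul_self, mul_one, ht]
  have htr : A₀.trace = 0 := by
    rw [hA₀, Matrix.trace_sub, Matrix.trace_smul, Matrix.trace_one, ht, smul_eq_mul,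
      div_mul_cancel₀ _ hD, sub_self]
  have hsum : ∑ x, ∑ y, A₀ x y * star (A₀ x y) =
      ∑ x, ∑ y, A x y * star (A x y) - t * star t * Fintype.card ι := by
    have e : ∀ x y, A₀ x y * star (A₀ x y) = A x y * star (A x y) -
        if x = y then t * star (A x x) + A x x * star t - t * star t else 0 := by
      intro x y
      by_cases hxy : x = y
      · subst hxy
        simp [hA₀]
        ring
      · simp [hA₀, hxy]
    have htD : A.trace = t * Fintype.card ι := by rw [ht, div_mul_cancel₀ _ hD]
    have hd : ∑ x, A x x = t * Fintype.card ι := htD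
    have hd' : ∑ x, star (A x x) = star t * Fintype.card ι := by
      rw [← star_sum, hd]
      simp
    simp only [e, Finset.sum_sub_distrib, Finset.sum_add_distrib, Finset.sum_ite_eq,
      Finset.mem_univ, if_true, ← Finset.mul_sum, ← Finset.sum_mul, hd, hd', Finset.sum_const,
      Finset.card_univ, nsmul_eq_mul]
    ring
  have hint := integral_cexpVal_mul_star A₀
  rw [htr, hsum] at hint
  have hz : ∀ z : ℂ, z * star z = ((‖z‖ ^ 2 : ℝ) : ℂ) := fun z => by
    simpa using Complex.mul_conj' z
  simp only [hz] at hint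
  rw [integral_complex_ofReal] at hint
  simp only [hdev]
  have hint' : ∫ ψ, ‖cexpVal (ψ : EuclideanSpace ℂ ι) A₀‖ ^ 2 ∂uniformState ι =
      1 / (Fintype.card ι * (Fintype.card ι + 1)) *
        (0 * 0 + (∑ x, ∑ y, ‖A x y‖ ^ 2 - ‖t‖ ^ 2 * Fintype.card ι)) := by
    apply Complex.ofReal_injective
    rw [hint]
    push_cast
    simp
  rw [hint', div_mul_eq_mul_div, one_mul]
  gcongr
  have : 0 ≤ ‖t‖ ^ 2 * (Fintype.card ι : ℝ) := by positivity
  linarith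

end TraceDeviation

/-! ### Tensor product operators, few-site matrix units and local projections -/

section SiteOperators


section Linear

variable {ι : Type*} [Fintype ι]

theorem cexpVal_sum_smul {κ : Type*} (s : Finset κ) (ψ : EuclideanSpace ℂ ι) (c : κ → ℂ)
    (A : κ → Matrix ι ι ℂ) :
    cexpVal ψ (∑ j ∈ s, c j • A j) = ∑ j ∈ s, c j * cexpVal ψ (A j) := by
  simp only [cexpVal, Matrix.sum_apply, Matrix.smul_apply, smul_eq_mul, Finset.mul_sum,
    Finset.sum_mul]
  refine Eq.trans (Finset.sum_congr rfl fun x _ => Finset.sum_comm) (Finset.sum_comm.trans ?_)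
  refine Finset.sum_congr rfl fun j _ => Finset.sum_congr rfl fun x _ =>
    Finset.sum_congr rfl fun y _ => ?_
  ring

theorem traceDev_sum_smul {κ : Type*} (s : Finset κ) (ψ : EuclideanSpace ℂ ι) (c : κ → ℂ)
    (A : κ → Matrix ι ι ℂ) :
    traceDev ψ (∑ j ∈ s, c j • A j) = ∑ j ∈ s, c j * traceDev ψ (A j) := by
  simp only [traceDev, cexpVal_sum_smul, Matrix.trace_sum, Matrix.trace_smul, mul_sub,
    Finset.sum_sub_distrib, Finset.sum_div, smul_eq_mul, mul_div_assoc]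

theorem norm_traceDev_sum_smul_le {κ : Type*} (s : Finset κ) (ψ : EuclideanSpace ℂ ι) (c : κ → ℂ)
    (A : κ → Matrix ι ι ℂ) {C δ : ℝ} (hc : ∀ j ∈ s, ‖c j‖ ≤ C)
    (hA : ∀ j ∈ s, ‖traceDev ψ (A j)‖ ≤ δ) (hC : 0 ≤ C) :
    ‖traceDev ψ (∑ j ∈ s, c j • A j)‖ ≤ s.card * (C * δ) := by
  rw [traceDev_sum_smul, ← nsmul_eq_mul]
  refine (norm_sum_le _ _).trans (Finset.sum_le_card_nsmul _ _ _ fun j hj => ?_)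
  rw [norm_mul]
  exact mul_le_mul (hc j hj) (hA j hj) (norm_nonneg _) hC

end Linear

variable {d n : ℕ}

theorem trace_tensorOp (M : Fin n → Matrix (Fin d) (Fin d) ℂ) :
    (tensorOp M).trace = ∏ i, (M i).trace := by
  simp only [Matrix.trace, Matrix.diag, Fintype.prod_sum, tensorOp, Matrix.of_apply]

theorem tensorOp_mul (M N : Fin n → Matrix (Fin d) (Fin d) ℂ) :
    tensorOp M * tensorOp N = tensorOp fun i => M i * N i := by
  ext x y
  simp only [Matrix.mul_apply, tensorOp, Matrix.of_apply, Fintype.prod_sum,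
    Finset.prod_mul_distrib]

theorem cexpVal_productVec_tensorOp (φ : Fin n → EuclideanSpace ℂ (Fin d))
    (M : Fin n → Matrix (Fin d) (Fin d) ℂ) :
    cexpVal (productVec φ) (tensorOp M) = ∏ i, cexpVal (φ i) (M i) := by
  simp only [cexpVal, Fintype.prod_sum, tensorOp, productVec, Matrix.of_apply, star_prod,
    Finset.prod_mul_distrib]

theorem sum_norm_sq_tensorOp (M : Fin n → Matrix (Fin d) (Fin d) ℂ) :
    ∑ x, ∑ y, ‖tensorOp M x y‖ ^ 2 = ∏ i, ∑ a, ∑ b, ‖M i a b‖ ^ 2 := by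
  simp only [Fintype.prod_sum, tensorOp, Matrix.of_apply, norm_prod, Finset.prod_pow]

/-- The operator `(⨂_{i ∈ U} |a_i⟩⟨b_i|) ⊗ I` in the computational basis. -/
def unitOp (U : Finset (Fin n)) (a b : U → Fin d) : Op d n :=
  tensorOp fun i => if h : i ∈ U then Matrix.single (a ⟨i, h⟩) (b ⟨i, h⟩) 1 else 1

/-- The squared Hilbert-Schmidt norm is multiplicative: a site in `U` contributes 1, any other site
d. -/
theorem sum_norm_sq_unitOp_le (hd : 0 < d) (U : Finset (Fin n)) (a b : U → Fin d) :
    ∑ x, ∑ y, ‖unitOp U a b x y‖ ^ 2 ≤ (d : ℝ) ^ n := by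
  have hd' : (1 : ℝ) ≤ d := by exact_mod_cast hd
  rw [unitOp, sum_norm_sq_tensorOp]
  calc _ ≤ ∏ _i : Fin n, (d : ℝ) := by
        refine Finset.prod_le_prod (fun i _ => by positivity) fun i _ => ?_
        by_cases h : i ∈ U
        · simp only [h, dite_true, Matrix.single_apply]
          refine le_trans (le_of_eq ?_) hd'
          rw [Finset.sum_eq_single (a ⟨i, h⟩) (by intro x _ hx; simp [hx.symm]) (by simp),
            Finset.sum_eq_single (b ⟨i, h⟩) (by intro x _ hx; simp [hx.symm]) (by simp)]
          simp
        · simp only [h, dite_false, Matrix.one_apply]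
          refine le_of_eq ?_
          simp [apply_ite]
    _ = (d : ℝ) ^ n := by simp

theorem tensorOp_eq_sum_unitOp (U : Finset (Fin n)) (M : Fin n → Matrix (Fin d) (Fin d) ℂ)
    (hM : ∀ i ∉ U, M i = 1) :
    tensorOp M = ∑ p : (U → Fin d) × (U → Fin d),
      (∏ i : U, M i (p.1 i) (p.2 i)) • unitOp U p.1 p.2 := by
  ext x y
  rw [Matrix.sum_apply, Finset.sum_eq_single (fun i : U => x i, fun i : U => y i)]
  · simp only [Matrix.smul_apply, unitOp, tensorOp, Matrix.of_apply, smul_eq_mul]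
    have hU : ∏ i ∈ U, M i (x i) (y i) = ∏ i, if i ∈ U then M i (x i) (y i) else 1 := by
      rw [Finset.prod_ite_mem, Finset.univ_inter]
    rw [Finset.prod_coe_sort U (fun i => M i (x i) (y i)), hU, ← Finset.prod_mul_distrib]
    refine Finset.prod_congr rfl fun i _ => ?_
    by_cases h : i ∈ U
    · simp [h]
    · simp [h, hM i h]
  · rintro ⟨a, b⟩ _ hne
    rw [Matrix.smul_apply]
    convert smul_zero _
    simp only [unitOp, tensorOp, Matrix.of_apply]
    by_contra h
    rw [← Ne, Finset.prod_ne_zero_iff] at h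
    refine hne (Prod.ext (funext fun i => ?_) (funext fun i => ?_))
    all_goals
      have := h i (Finset.mem_univ _)
      simp only [i.2, dite_true, Matrix.single_apply, ne_eq, ite_eq_right_iff, one_ne_zero,
        imp_false, not_not] at this
      first | exact this.1 | exact this.2
  · simp

/-- Passes from the fixed computational matrix units to arbitrary local bases: there are d^(2|U|)
units, with coefficients of modulus at most 1. -/
theorem norm_traceDev_tensorOp_le (ψ : NQudit d n) (U : Finset (Fin n))
    (M : Fin n → Matrix (Fin d) (Fin d) ℂ) (hM : ∀ i ∉ U, M i = 1)
    (hM' : ∀ i a b, ‖M i a b‖ ≤ 1) {ε : ℝ} (hε : ∀ a b, ‖traceDev ψ (unitOp U a b)‖ ≤ ε) :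
    ‖traceDev ψ (tensorOp M)‖ ≤ (d : ℝ) ^ (2 * U.card) * ε := by
  rw [tensorOp_eq_sum_unitOp U M hM]
  refine (norm_traceDev_sum_smul_le _ ψ _ _ (C := 1) (δ := ε) (fun p _ => ?_)
    (fun p _ => hε _ _) zero_le_one).trans (le_of_eq ?_)
  · rw [norm_prod]
    exact Finset.prod_le_one (fun _ _ => norm_nonneg _) fun _ _ => hM' _ _ _
  · simp [Finset.card_univ, ← pow_add, two_mul]

/-- Single-site factors of products of local projections: `I`, `0`, or `|φ_j⟩⟨φ_j|`. -/
def IsSiteOp (φ : OrthonormalBasis (Fin d) ℂ (EuclideanSpace ℂ (Fin d)))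
    (M : Matrix (Fin d) (Fin d) ℂ) : Prop :=
  M = 1 ∨ M = 0 ∨ ∃ j, M = ketbra (φ j)

theorem cexpVal_ketbra (v w : EuclideanSpace ℂ (Fin d)) :
    cexpVal v (ketbra w) = inner ℂ v w * inner ℂ w v := by
  simp only [cexpVal, ketbra, Matrix.of_apply, PiLp.inner_apply, RCLike.inner_apply,
    Finset.sum_mul_sum]
  refine Finset.sum_congr rfl fun x _ => Finset.sum_congr rfl fun y _ => ?_
  simp only [RCLike.star_def]
  ring

theorem cexpVal_one (v : EuclideanSpace ℂ (Fin d)) : cexpVal v 1 = inner ℂ v v := by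
  simp only [cexpVal, PiLp.inner_apply, RCLike.inner_apply, Matrix.one_apply, mul_ite, mul_one,
    mul_zero, ite_mul, zero_mul, Finset.sum_ite_eq, Finset.mem_univ, if_true]
  exact Finset.sum_congr rfl fun x _ => mul_comm _ _

theorem trace_ketbra (w : EuclideanSpace ℂ (Fin d)) : (ketbra w).trace = inner ℂ w w := by
  simp only [Matrix.trace, Matrix.diag, ketbra, Matrix.of_apply, PiLp.inner_apply,
    RCLike.inner_apply, RCLike.star_def]

theorem ketbra_mul_ketbra (v w : EuclideanSpace ℂ (Fin d)) :
    ketbra v * ketbra w = Matrix.of fun a b => inner ℂ v w * (v a * star (w b)) := by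
  ext a b
  simp only [Matrix.mul_apply, ketbra, Matrix.of_apply, PiLp.inner_apply, RCLike.inner_apply,
    Finset.sum_mul, RCLike.star_def]
  exact Finset.sum_congr rfl fun x _ => by ring

variable {φ : OrthonormalBasis (Fin d) ℂ (EuclideanSpace ℂ (Fin d))}

/-- Orthogonality of the common basis, and the reason 0 is admitted: this closure brings H² under
the same analysis as H. -/
theorem IsSiteOp.mul {M N : Matrix (Fin d) (Fin d) ℂ} (hM : IsSiteOp φ M) (hN : IsSiteOp φ N) :
    IsSiteOp φ (M * N) := by
  rcases hM with rfl | rfl | ⟨i, rfl⟩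
  · simpa using hN
  · right; left; simp
  · rcases hN with rfl | rfl | ⟨j, rfl⟩
    · right; right; exact ⟨i, by simp⟩
    · right; left; simp
    · rw [ketbra_mul_ketbra, orthonormal_iff_ite.1 φ.orthonormal]
      by_cases h : i = j
      · subst h
        right; right
        exact ⟨i, by ext; simp [ketbra]⟩
      · right; left
        ext
        simp [h]

theorem IsSiteOp.norm_apply_le {M : Matrix (Fin d) (Fin d) ℂ} (hM : IsSiteOp φ M) (a b : Fin d) :
    ‖M a b‖ ≤ 1 := by
  rcases hM with rfl | rfl | ⟨i, rfl⟩
  · rw [Matrix.one_apply]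
    split_ifs <;> simp
  · simp
  · have h : ∀ a, ‖φ i a‖ ≤ 1 := fun a => (PiLp.norm_apply_le (φ i) a).trans (by simp)
    simp only [ketbra, Matrix.of_apply, norm_mul, norm_star]
    exact mul_le_one₀ (h a) (norm_nonneg _) (h b)

theorem IsSiteOp.norm_trace_le (hd : 0 < d) {M : Matrix (Fin d) (Fin d) ℂ} (hM : IsSiteOp φ M) :
    ‖M.trace‖ ≤ d := by
  rcases hM with rfl | rfl | ⟨i, rfl⟩
  · simp
  · simp
  · rw [trace_ketbra]
    simp
    exact_mod_cast hd

/-- The uniform superposition of the vectors of an orthonormal basis. -/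
def uniformSuperposition (φ : OrthonormalBasis (Fin d) ℂ (EuclideanSpace ℂ (Fin d))) :
    EuclideanSpace ℂ (Fin d) :=
  ∑ j, (((√d)⁻¹ : ℝ) : ℂ) • φ j

theorem inner_uniformSuperposition_left (j : Fin d) :
    inner ℂ (φ j) (uniformSuperposition φ) = (((√d)⁻¹ : ℝ) : ℂ) :=
  φ.orthonormal.inner_right_fintype _ j

theorem inner_uniformSuperposition_right (j : Fin d) :
    inner ℂ (uniformSuperposition φ) (φ j) = (((√d)⁻¹ : ℝ) : ℂ) := by
  rw [← inner_conj_symm, inner_uniformSuperposition_left, Complex.conj_ofReal]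

theorem inv_sqrt_mul_inv_sqrt : (((√d)⁻¹ : ℝ) : ℂ) * (((√d)⁻¹ : ℝ) : ℂ) = 1 / (d : ℂ) := by
  rw [← Complex.ofReal_mul, ← mul_inv, Real.mul_self_sqrt (Nat.cast_nonneg d)]
  simp

theorem inner_uniformSuperposition_self (hd : 0 < d) :
    inner ℂ (uniformSuperposition φ) (uniformSuperposition φ) = (1 : ℂ) := by
  conv_lhs => rw [← φ.sum_inner_mul_inner]
  simp only [inner_uniformSuperposition_left, inner_uniformSuperposition_right,
    inv_sqrt_mul_inv_sqrt]
  have : (d : ℂ) ≠ 0 := by exact_mod_cast hd.ne'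
  simp [this]

theorem norm_uniformSuperposition (hd : 0 < d) : ‖uniformSuperposition φ‖ = 1 := by
  rw [@norm_eq_sqrt_re_inner ℂ, inner_uniformSuperposition_self hd]
  simp

theorem IsSiteOp.cexpVal_uniformSuperposition (hd : 0 < d) {M : Matrix (Fin d) (Fin d) ℂ}
    (hM : IsSiteOp φ M) : cexpVal (uniformSuperposition φ) M = M.trace / d := by
  have : (d : ℂ) ≠ 0 := by exact_mod_cast hd.ne'
  rcases hM with rfl | rfl | ⟨i, rfl⟩
  · rw [cexpVal_one, inner_uniformSuperposition_self hd]
    simp [this]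
  · simp [cexpVal]
  · rw [cexpVal_ketbra, trace_ketbra, inner_uniformSuperposition_left,
      inner_uniformSuperposition_right, inv_sqrt_mul_inv_sqrt]
    simp

/-- Expectation and trace both factor over sites, and at each site they agree after division by d.
-/
theorem traceDev_uniformSuperposition (hd : 0 < d) (φ : ProductBasis d n)
    {M : Fin n → Matrix (Fin d) (Fin d) ℂ} (hM : ∀ i, IsSiteOp (φ i) (M i)) :
    traceDev (productVec fun i => uniformSuperposition (φ i)) (tensorOp M) = 0 := by
  rw [traceDev, cexpVal_productVec_tensorOp, trace_tensorOp,
    Finset.prod_congr rfl fun i _ => (hM i).cexpVal_uniformSuperposition hd,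
    Finset.prod_div_distrib]
  simp

end SiteOperators

/-! ### Few-site mixedness bounds the advantage over separable states -/

section DeterministicBound


variable {d n : ℕ}

theorem norm_cexpVal_uniformSuperposition_le (hd : 0 < d) (φ : ProductBasis d n)
    {M : Fin n → Matrix (Fin d) (Fin d) ℂ} (hM : ∀ i, IsSiteOp (φ i) (M i)) :
    ‖cexpVal (productVec fun i => uniformSuperposition (φ i)) (tensorOp M)‖ ≤ 1 := by
  rw [cexpVal_productVec_tensorOp, norm_prod]
  refine Finset.prod_le_one (fun _ _ => norm_nonneg _) fun i _ => ?_
  rw [(hM i).cexpVal_uniformSuperposition hd, norm_div, Complex.norm_natCast]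
  exact div_le_one_of_le₀ ((hM i).norm_trace_le hd) (Nat.cast_nonneg d)

/-- Deterministic bound: if the reduced states of `ψ` on few sites are almost maximally mixed,
then `ψ` has almost no advantage over separable states for Hamiltonians with few-body terms. -/
theorem qfi_sub_maxSepQFI_le (hd : 0 < d) {κ : Type*} (J : Finset κ) (φ : ProductBasis d n)
    (c : κ → ℝ) (U : κ → Finset (Fin n)) (M : κ → Fin n → Matrix (Fin d) (Fin d) ℂ)
    {B N ε : ℝ} {k : ℕ} (hc : ∀ j ∈ J, |c j| ≤ B) (hB : 0 ≤ B) (hN : (J.card : ℝ) ≤ N)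
    (hU : ∀ j ∈ J, (U j).card ≤ k) (hMU : ∀ j, ∀ i ∉ U j, M j i = 1)
    (hM : ∀ j i, IsSiteOp (φ i) (M j i)) (hε : 0 ≤ ε) (ψ : NQudit d n)
    (hψ : ∀ V : Finset (Fin n), V.card ≤ 2 * k → ∀ a b, ‖traceDev ψ (unitOp V a b)‖ ≤ ε) :
    qfi ψ (∑ j ∈ J, (c j : ℂ) • tensorOp (M j)) -
        maxSepQFI (∑ j ∈ J, (c j : ℂ) • tensorOp (M j)) ≤
      12 * (B ^ 2 * N ^ 2 * (d : ℝ) ^ (4 * k)) * ε := by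
  classical
  have hd' : (1 : ℝ) ≤ d := by exact_mod_cast hd
  set Φ : NQudit d n := productVec fun i => uniformSuperposition (φ i)
  set H : Op d n := ∑ j ∈ J, (c j : ℂ) • tensorOp (M j) with hH
  have hN0 : 0 ≤ N := (Nat.cast_nonneg _).trans hN
  have hHH : H * H = ∑ p ∈ J ×ˢ J, ((c p.1 : ℂ) * c p.2) •
      tensorOp (fun i => M p.1 i * M p.2 i) := by
    rw [hH, Finset.sum_mul_sum, Finset.sum_product]
    refine Finset.sum_congr rfl fun j _ => Finset.sum_congr rfl fun l _ => ?_
    rw [smul_mul_smul_comm, tensorOp_mul]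
  have hcn : ∀ j ∈ J, ‖(c j : ℂ)‖ ≤ B := fun j hj => by
    rw [Complex.norm_real]
    exact hc j hj
  have hΦ1 : traceDev Φ H = 0 := by
    rw [hH, traceDev_sum_smul]
    exact Finset.sum_eq_zero fun j _ => by rw [traceDev_uniformSuperposition hd φ (hM j), mul_zero]
  have hΦ2 : traceDev Φ (H * H) = 0 := by
    rw [hHH, traceDev_sum_smul]
    exact Finset.sum_eq_zero fun p _ => by
      rw [traceDev_uniformSuperposition hd φ fun i => (hM p.1 i).mul (hM p.2 i), mul_zero]
  have hΦm : ‖cexpVal Φ H‖ ≤ B * N := by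
    rw [hH, cexpVal_sum_smul]
    calc _ ≤ J.card • (B * 1) := by
          refine (norm_sum_le _ _).trans (Finset.sum_le_card_nsmul _ _ _ fun j hj => ?_)
          rw [norm_mul]
          exact mul_le_mul (hcn j hj) (norm_cexpVal_uniformSuperposition_le hd φ (hM j)) (norm_nonneg _) hB
      _ ≤ B * N := by
          rw [nsmul_eq_mul, mul_one, mul_comm]
          gcongr
  have hψ1 : ‖traceDev ψ H‖ ≤ N * (B * ((d : ℝ) ^ (4 * k) * ε)) := by
    refine (norm_traceDev_sum_smul_le J ψ _ _ (C := B) (δ := (d : ℝ) ^ (4 * k) * ε) hcn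
      (fun j hj => ?_) hB).trans (by gcongr)
    refine (norm_traceDev_tensorOp_le ψ (U j) (M j) (hMU j) (fun i => (hM j i).norm_apply_le)
      (hψ (U j) ((hU j hj).trans (by lia)))).trans ?_
    have := hU j hj
    exact mul_le_mul_of_nonneg_right (pow_le_pow_right₀ hd' (by lia)) hε
  have hψ2 : ‖traceDev ψ (H * H)‖ ≤ N * N * (B * B * ((d : ℝ) ^ (4 * k) * ε)) := by
    rw [hHH]
    refine (norm_traceDev_sum_smul_le (J ×ˢ J) ψ _ _ (C := B * B)
      (δ := (d : ℝ) ^ (4 * k) * ε) (fun p hp => ?_) (fun p hp => ?_) (by positivity)).trans ?_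
    · rw [Finset.mem_product] at hp
      rw [norm_mul]
      exact mul_le_mul (hcn _ hp.1) (hcn _ hp.2) (norm_nonneg _) hB
    · rw [Finset.mem_product] at hp
      -- A term of H² acts on two supports jointly, hence the hypothesis on sets of up to 2k sites
      -- and the exponent 4k.
      have hcard : (U p.1 ∪ U p.2).card ≤ 2 * k := by
        have := Finset.card_union_le (U p.1) (U p.2)
        have := hU _ hp.1
        have := hU _ hp.2
        lia
      refine (norm_traceDev_tensorOp_le ψ (U p.1 ∪ U p.2) _ (fun i hi => ?_)
        (fun i => ((hM p.1 i).mul (hM p.2 i)).norm_apply_le) (hψ _ hcard)).trans ?_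
      · rw [Finset.notMem_union] at hi
        rw [hMU _ _ hi.1, hMU _ _ hi.2, one_mul]
      · exact mul_le_mul_of_nonneg_right (pow_le_pow_right₀ hd' (by lia)) hε
    · rw [Finset.card_product, Nat.cast_mul]
      gcongr
  have hsep : qfi Φ H ≤ maxSepQFI H :=
    (exists_qfi_eq_maxSepQFI hd H).2 fun i =>
      ⟨uniformSuperposition (φ i), by simp [norm_uniformSuperposition hd]⟩
  have e1 : cexpVal ψ H = cexpVal Φ H + traceDev ψ H := by
    rw [← sub_zero (traceDev ψ H), ← hΦ1]
    simp only [traceDev]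
    ring
  have e2 : cexpVal ψ (H * H) = cexpVal Φ (H * H) + traceDev ψ (H * H) := by
    rw [← sub_zero (traceDev ψ (H * H)), ← hΦ2]
    simp only [traceDev]
    ring
  have r1 : expVal ψ H = expVal Φ H + (traceDev ψ H).re := congrArg Complex.re e1
  have r2 : expVal ψ (H * H) = expVal Φ (H * H) + (traceDev ψ (H * H)).re :=
    congrArg Complex.re e2
  have b1 : |(traceDev ψ H).re| ≤ N * (B * ((d : ℝ) ^ (4 * k) * ε)) :=
    (Complex.abs_re_le_norm _).trans hψ1
  have b2 : (traceDev ψ (H * H)).re ≤ N * N * (B * B * ((d : ℝ) ^ (4 * k) * ε)) :=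
    (Complex.re_le_norm _).trans hψ2
  have b3 : |expVal Φ H| ≤ B * N := (Complex.abs_re_le_norm _).trans hΦm
  have b4 : -(expVal Φ H * (traceDev ψ H).re) ≤
      (B * N) * (N * (B * ((d : ℝ) ^ (4 * k) * ε))) := by
    refine (neg_le_abs _).trans ?_
    rw [abs_mul]
    exact mul_le_mul b3 b1 (abs_nonneg _) (by positivity)
  -- The factor 12 is 4(1 + 2): one unit from H², two from the cross term of ⟨H⟩². The squared
  -- deviation enters negatively and is dropped.
  calc qfi ψ H - maxSepQFI H ≤ qfi ψ H - qfi Φ H := by linarith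
    _ = 4 * ((traceDev ψ (H * H)).re - 2 * (expVal Φ H * (traceDev ψ H).re)
          - (traceDev ψ H).re ^ 2) := by
        unfold qfi
        rw [r1, r2]
        ring
    _ ≤ 12 * (B ^ 2 * N ^ 2 * (d : ℝ) ^ (4 * k)) * ε := by
        have := sq_nonneg (traceDev ψ H).re
        linarith

/-- Compare ∑ C(n,i) with the binomial expansion ∑ C(k,i) nⁱ, using C(n,i) ≤ nⁱ. -/
theorem card_filter_card_le (n k : ℕ) :
    ((Finset.univ : Finset (Finset (Fin n))).filter fun S => S.card ≤ k).card ≤ (n + 1) ^ k := by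
  have h : ((Finset.univ : Finset (Finset (Fin n))).filter fun S => S.card ≤ k) =
      (Finset.range (k + 1)).biUnion fun i => Finset.powersetCard i Finset.univ := by
    ext S
    simp [Finset.mem_powersetCard]
  rw [h, add_pow]
  refine Finset.card_biUnion_le.trans (Finset.sum_le_sum fun i hi => ?_)
  rw [Finset.card_powersetCard, Finset.card_univ, Fintype.card_fin, one_pow, mul_one]
  have : 1 ≤ k.choose i := Nat.choose_pos (Nat.lt_succ_iff.1 (Finset.mem_range.1 hi))
  exact (Nat.choose_le_pow n i).trans (Nat.le_mul_of_pos_right _ this)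

theorem card_sigma_filter_card_le (hd : 0 < d) (n k : ℕ) :
    (((Finset.univ : Finset (Finset (Fin n))).filter fun S => S.card ≤ k).sigma
      fun S => (Finset.univ : Finset (S → Fin d))).card ≤ (n + 1) ^ k * d ^ k := by
  rw [Finset.card_sigma]
  refine (Finset.sum_le_card_nsmul _ _ (d ^ k) fun S hS => ?_).trans ?_
  · simp only [Finset.card_univ, Fintype.card_fun, Fintype.card_fin, Fintype.card_coe]
    exact Nat.pow_le_pow_right hd (Finset.mem_filter.1 hS).2
  · rw [smul_eq_mul]
    exact Nat.mul_le_mul_right _ (card_filter_card_le n k)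

theorem IsKBodyLD.mono {k l : ℕ} (hkl : k ≤ l) {B : ℝ} (hB : 0 ≤ B) {H : Op d n}
    (hH : IsKBodyLD d n k B H) : IsKBodyLD d n l B H := by
  obtain ⟨φ, a, ha, rfl⟩ := hH
  refine ⟨φ, fun S x => if S.card ≤ k then a S x else 0, fun S x => ?_, ?_⟩
  · dsimp only
    split_ifs
    · exact ha S x
    · simpa using hB
  · refine Finset.sum_subset_zero_on_sdiff (fun S hS => ?_) (fun S hS => ?_) fun S hS => ?_
    · simp only [Finset.mem_filter, Finset.mem_univ, true_and] at hS ⊢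
      lia
    · simp only [Finset.mem_sdiff, Finset.mem_filter, Finset.mem_univ, true_and] at hS
      simp [hS.2]
    · simp only [(Finset.mem_filter.1 hS).2, if_true]

theorem tensorOp_update_sum_smul (i : Fin n) (c : Fin d → ℂ)
    (A : Fin d → Matrix (Fin d) (Fin d) ℂ) :
    tensorOp (Function.update (fun _ => 1) i (∑ j, c j • A j)) =
      ∑ j, c j • tensorOp (Function.update (fun _ => 1) i (A j)) := by
  have h : ∀ (C : Matrix (Fin d) (Fin d) ℂ) (x y : Fin n → Fin d),
      tensorOp (Function.update (fun _ => 1) i C) x y = C (x i) (y i) *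
        ∏ t ∈ Finset.univ.erase i, (1 : Matrix (Fin d) (Fin d) ℂ) (x t) (y t) := by
    intro C x y
    simp only [tensorOp, Matrix.of_apply]
    rw [← Finset.mul_prod_erase _ _ (Finset.mem_univ i), Function.update_self]
    congr 1
    refine Finset.prod_congr rfl fun t ht => ?_
    rw [Function.update_of_ne (Finset.ne_of_mem_erase ht)]
  ext x y
  simp only [Matrix.sum_apply, Matrix.smul_apply, h, smul_eq_mul, Finset.sum_mul, mul_assoc]

theorem IsLinear.isKBodyLD {B : ℝ} (hB : 0 ≤ B) {H : Op d n} (hH : IsLinear d n B H) :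
    IsKBodyLD d n 1 B H := by
  obtain ⟨φ, l, hl, rfl⟩ := hH
  -- The sum over `S` has a single term when `S` is a singleton; it avoids naming the element.
  refine ⟨φ, fun S x => if S.card = 1 then ∑ i : S, l i (x i) else 0, fun S x => ?_, ?_⟩
  · dsimp only
    split_ifs with h
    · obtain ⟨i, rfl⟩ := Finset.card_eq_one.1 h
      rw [Fintype.sum_unique]
      exact hl _ _
    · simpa using hB
  · have hsub : Finset.powersetCard 1 (Finset.univ : Finset (Fin n)) ⊆
        Finset.univ.filter fun S => S.card ≤ 1 := fun S hS => by
      simpa using (Finset.mem_powersetCard.1 hS).2.le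
    rw [← Finset.sum_subset hsub fun S _ hS => ?_]
    · rw [Finset.powersetCard_one, Finset.sum_map]
      refine Finset.sum_congr rfl fun i _ => ?_
      rw [tensorOp_update_sum_smul]
      refine (Fintype.sum_equiv (Equiv.funUnique ({i} : Finset (Fin n)) (Fin d)) _ _
        fun x => ?_).symm
      simp only [Function.Embedding.coeFn_mk, Finset.card_singleton, if_true, Fintype.sum_unique]
      congr 1
      unfold localProj
      congr 1
      funext t
      by_cases h : t = i
      · subst h
        simp
        rfl
      · simp [h]
    · have : S.card ≠ 1 := fun h => hS (Finset.mem_powersetCard.2 ⟨Finset.subset_univ _, h⟩)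
      simp [this]

/-- Both kinds of Hamiltonian are (k+1)-body; the shift by one covers linear ones even when k = 0.
-/
theorem qfi_sub_maxSepQFI_le_of_mem (hd : 0 < d) {k : ℕ} {B ε : ℝ} (hB : 0 ≤ B) (hε : 0 ≤ ε)
    {H : Op d n} (hH : H ∈ hamiltonianSet d n k B) (ψ : NQudit d n)
    (hψ : ∀ V : Finset (Fin n), V.card ≤ 2 * (k + 1) →
      ∀ a b, ‖traceDev ψ (unitOp V a b)‖ ≤ ε) :
    qfi ψ H - maxSepQFI H ≤
      12 * (B ^ 2 * (((n : ℝ) + 1) ^ (k + 1) * (d : ℝ) ^ (k + 1)) ^ 2 *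
        (d : ℝ) ^ (4 * (k + 1))) * ε := by
  have hH' : IsKBodyLD d n (k + 1) B H :=
    hH.elim (fun h => (h.isKBodyLD hB).mono (by lia) hB) fun h => h.mono (by lia) hB
  obtain ⟨φ, a, ha, rfl⟩ := hH'
  rw [← Finset.sum_sigma _ (fun S : Finset (Fin n) => (Finset.univ : Finset (S → Fin d)))
    (fun p : (S : Finset (Fin n)) × (S → Fin d) => (a p.1 p.2 : ℂ) • localProj φ p.1 p.2)]
  have hcard : ((((Finset.univ : Finset (Finset (Fin n))).filter fun S => S.card ≤ k + 1).sigma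
      fun S => (Finset.univ : Finset (S → Fin d))).card : ℝ) ≤
      ((n : ℝ) + 1) ^ (k + 1) * (d : ℝ) ^ (k + 1) := by
    exact_mod_cast card_sigma_filter_card_le hd n (k + 1)
  unfold localProj
  refine qfi_sub_maxSepQFI_le (k := k + 1) hd _ φ
    (fun p : (S : Finset (Fin n)) × (S → Fin d) => a p.1 p.2) (fun p => p.1)
    (fun p i => if h : i ∈ p.1 then ketbra (φ i (p.2 ⟨i, h⟩)) else 1)
    (fun p _ => ha _ _) hB hcard ?_ ?_ ?_ hε ψ hψ
  · intro p hp
    exact (Finset.mem_filter.1 (Finset.mem_sigma.1 hp).1).2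
  · intro p i hi
    simp [hi]
  · intro p i
    by_cases h : i ∈ p.1
    · exact Or.inr (Or.inr ⟨p.2 ⟨i, h⟩, by simp [h]⟩)
    · exact Or.inl (by simp [h])

end DeterministicBound

/-! ### Chebyshev, the union bound and exponential decay -/

section Probability


theorem uniformState_le_norm_traceDev {ι : Type*} [Fintype ι] [Nonempty ι]
    (A : Matrix ι ι ℂ) (hA : ∑ x, ∑ y, ‖A x y‖ ^ 2 ≤ (Fintype.card ι : ℝ)) {ε : ℝ} (hε : 0 < ε) :
    (uniformState ι).real {ψ | ε ≤ ‖traceDev (ψ : EuclideanSpace ℂ ι) A‖} ≤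
      1 / (Fintype.card ι * ε ^ 2) := by
  classical
  have hD : (0 : ℝ) < Fintype.card ι := by exact_mod_cast Fintype.card_pos
  have hcont : Continuous fun ψ : EuclideanSpace ℂ ι => ‖traceDev ψ A‖ ^ 2 :=
    (continuous_traceDev A).norm.pow 2
  have h := mul_meas_ge_le_integral_of_nonneg (μ := uniformState ι)
    (f := fun ψ => ‖traceDev (ψ : EuclideanSpace ℂ ι) A‖ ^ 2)
    (Eventually.of_forall fun ψ => by positivity) (integrable_uniformState hcont) (ε ^ 2)
  have hset : {ψ : Metric.sphere (0 : EuclideanSpace ℂ ι) 1 |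
      ε ^ 2 ≤ ‖traceDev (ψ : EuclideanSpace ℂ ι) A‖ ^ 2} =
      {ψ : Metric.sphere (0 : EuclideanSpace ℂ ι) 1 |
        ε ≤ ‖traceDev (ψ : EuclideanSpace ℂ ι) A‖} := by
    ext ψ
    exact pow_le_pow_iff_left₀ hε.le (norm_nonneg _) two_ne_zero
  rw [hset] at h
  have h2 := (h.trans (integral_norm_traceDev_sq_le A)).trans
    (div_le_div_of_nonneg_right hA (by positivity))
  rw [le_div_iff₀ (by positivity)]
  rw [le_div_iff₀ (by positivity)] at h2
  have hp : 0 ≤ (uniformState ι).real {ψ | ε ≤ ‖traceDev (ψ : EuclideanSpace ℂ ι) A‖} * ε ^ 2 := by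
    positivity
  refine le_of_mul_le_mul_left ?_ hD
  nlinarith

theorem card_sigma_pairs_le {d : ℕ} (hd : 0 < d) (n k : ℕ) :
    (((Finset.univ : Finset (Finset (Fin n))).filter fun S => S.card ≤ 2 * k).sigma
      fun S => (Finset.univ : Finset ((S → Fin d) × (S → Fin d)))).card ≤
      (n + 1) ^ (2 * k) * d ^ (4 * k) := by
  rw [Finset.card_sigma]
  refine (Finset.sum_le_card_nsmul _ _ (d ^ (4 * k)) fun S hS => ?_).trans ?_
  · simp only [Finset.card_univ, Fintype.card_prod, Fintype.card_fun, Fintype.card_fin,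
      Fintype.card_coe, ← pow_add]
    have := (Finset.mem_filter.1 hS).2
    exact Nat.pow_le_pow_right hd (by lia)
  · rw [smul_eq_mul]
    exact Nat.mul_le_mul_right _ (card_filter_card_le n _)

theorem haarState_exists_le_norm_traceDev {d : ℕ} (hd : 0 < d) (n k : ℕ) {ε : ℝ} (hε : 0 < ε) :
    (haarState d n).real {ψ | ∃ V : Finset (Fin n), V.card ≤ 2 * k ∧
      ∃ a b, ε ≤ ‖traceDev (ψ : NQudit d n) (unitOp V a b)‖} ≤
      ((n : ℝ) + 1) ^ (2 * k) * (d : ℝ) ^ (4 * k) * (1 / ((d : ℝ) ^ n * ε ^ 2)) := by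
  have : Nonempty (Fin d) := ⟨⟨0, hd⟩⟩
  have : IsProbabilityMeasure (haarState d n) := isProbabilityMeasure_haarState hd
  set J := (((Finset.univ : Finset (Finset (Fin n))).filter fun S => S.card ≤ 2 * k).sigma
      fun S => (Finset.univ : Finset ((S → Fin d) × (S → Fin d)))) with hJ
  have hsub : {ψ : Metric.sphere (0 : NQudit d n) 1 | ∃ V : Finset (Fin n), V.card ≤ 2 * k ∧
      ∃ a b, ε ≤ ‖traceDev (ψ : NQudit d n) (unitOp V a b)‖} ⊆
      ⋃ p ∈ J, {ψ | ε ≤ ‖traceDev (ψ : NQudit d n) (unitOp p.1 p.2.1 p.2.2)‖} := by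
    rintro ψ ⟨V, hV, a, b, h⟩
    simp only [Set.mem_iUnion]
    exact ⟨⟨V, a, b⟩, by simp [hJ, hV], h⟩
  have hcard' : (Fintype.card (Fin n → Fin d) : ℝ) = (d : ℝ) ^ n := by simp
  refine (measureReal_mono hsub (measure_ne_top _ _)).trans ((measureReal_biUnion_finset_le _ _).trans ?_)
  refine (Finset.sum_le_card_nsmul _ _ (1 / ((d : ℝ) ^ n * ε ^ 2)) fun p _ => ?_).trans ?_
  · rw [← hcard']
    exact uniformState_le_norm_traceDev _ (by rw [hcard']; exact sum_norm_sq_unitOp_le hd _ _ _) hε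
  · rw [nsmul_eq_mul]
    refine mul_le_mul_of_nonneg_right ?_ (by positivity)
    exact_mod_cast card_sigma_pairs_le hd n k

theorem traceDev_eq_zero_of_unique {ι : Type*} [Fintype ι] [Unique ι]
    (ψ : Metric.sphere (0 : EuclideanSpace ℂ ι) 1) (A : Matrix ι ι ℂ) :
    traceDev (ψ : EuclideanSpace ℂ ι) A = 0 := by
  have h := sum_star_mul_self ψ
  rw [Fintype.sum_unique] at h
  simp only [traceDev, cexpVal, Matrix.trace, Matrix.diag, Fintype.sum_unique, Fintype.card_unique,
    Nat.cast_one, div_one]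
  linear_combination A default default * h

theorem isLittleO_mul_log {k : ℕ → ℕ}
    (hk : (fun n => (k n : ℝ)) =o[atTop] fun n : ℕ => (n : ℝ) / Real.log n) :
    (fun n : ℕ => ((k n : ℝ) + 1) * Real.log (n + 1)) =o[atTop] fun n : ℕ => (n : ℝ) := by
  have hlog : (fun n : ℕ => Real.log (n + 1)) =O[atTop] fun n : ℕ => Real.log n := by
    refine IsBigO.of_bound 2 ?_
    filter_upwards [eventually_ge_atTop 2] with n hn
    have hn' : (2 : ℝ) ≤ n := by exact_mod_cast hn
    rw [Real.norm_of_nonneg (Real.log_nonneg (by linarith)),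
      Real.norm_of_nonneg (Real.log_nonneg (by linarith))]
    calc Real.log (n + 1) ≤ Real.log ((n : ℝ) ^ 2) :=
          Real.log_le_log (by linarith) (by nlinarith)
      _ = 2 * Real.log n := by rw [Real.log_pow]; norm_num
  have h1 : (fun n : ℕ => (k n : ℝ) * Real.log (n + 1)) =o[atTop] fun n : ℕ => (n : ℝ) := by
    refine (hk.mul_isBigO hlog).trans_eventuallyEq ?_
    filter_upwards [eventually_ge_atTop 2] with n hn
    have hn' : (2 : ℝ) ≤ n := by exact_mod_cast hn
    exact div_mul_cancel₀ _ (Real.log_pos (by linarith)).ne'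
  have h2 : (fun n : ℕ => Real.log (n + 1)) =o[atTop] fun n : ℕ => (n : ℝ) :=
    hlog.trans_isLittleO (Real.isLittleO_log_id_atTop.comp_tendsto tendsto_natCast_atTop_atTop)
  simpa [add_mul] using h1.add h2

/-- In the logarithm every numerator term is o(n), while the denominator contributes -n log d with
log d > 0. -/
theorem tendsto_exponential_decay {d : ℕ} (hd : 2 ≤ d) {k : ℕ → ℕ}
    (hk : (fun n => (k n : ℝ)) =o[atTop] fun n : ℕ => (n : ℝ) / Real.log n)
    {B : ℕ → ℝ} (hB : ∀ n, 0 < B n)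
    (hBo : (fun n => Real.log (B n)) =o[atTop] fun n : ℕ => (n : ℝ)) :
    Tendsto (fun n : ℕ => B n ^ 4 * ((n : ℝ) + 1) ^ (6 * (k n + 1)) *
      (d : ℝ) ^ (16 * (k n + 1)) / (d : ℝ) ^ n) atTop (𝓝 0) := by
  have hd' : (2 : ℝ) ≤ d := by exact_mod_cast hd
  have hd0 : (0 : ℝ) < d := by linarith
  have hL : 0 < Real.log d := Real.log_pos (by linarith)
  have h1 := isLittleO_mul_log hk
  have h2 : (fun n : ℕ => (k n : ℝ) + 1) =o[atTop] fun n : ℕ => (n : ℝ) := by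
    refine IsBigO.trans_isLittleO (IsBigO.of_bound 1 ?_) h1
    filter_upwards [eventually_ge_atTop 2] with n hn
    have hn' : (2 : ℝ) ≤ n := by exact_mod_cast hn
    have hk0 : (0 : ℝ) ≤ (k n : ℝ) + 1 := by positivity
    have hl : 1 ≤ Real.log ((n : ℝ) + 1) := by
      rw [Real.le_log_iff_exp_le (by linarith)]
      have := Real.exp_one_lt_d9
      linarith
    rw [Real.norm_of_nonneg hk0, Real.norm_of_nonneg (by positivity), one_mul]
    exact le_mul_of_one_le_right hk0 hl
  have h3 := ((hBo.const_mul_left 4).add (h1.const_mul_left 6)).add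
    (h2.const_mul_left (16 * Real.log d))
  have h4 : Tendsto (fun n : ℕ => 4 * Real.log (B n) + 6 * (((k n : ℝ) + 1) * Real.log (n + 1)) +
      16 * Real.log d * ((k n : ℝ) + 1) - n * Real.log d) atTop atBot := by
    have h5 : Tendsto (fun n : ℕ => -(Real.log d / 2) * (n : ℝ)) atTop atBot :=
      tendsto_natCast_atTop_atTop.const_mul_atTop_of_neg (by linarith)
    refine tendsto_atBot_mono' _ ?_ h5
    filter_upwards [h3.bound (half_pos hL)] with n hn
    rw [Real.norm_natCast] at hn
    have := (le_abs_self _).trans hn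
    linarith
  refine (Real.tendsto_exp_atBot.comp h4).congr fun n => ?_
  have hn : (0 : ℝ) < (n : ℝ) + 1 := by positivity
  have e : 4 * Real.log (B n) + 6 * (((k n : ℝ) + 1) * Real.log (n + 1)) +
      16 * Real.log d * ((k n : ℝ) + 1) - n * Real.log d =
      Real.log (B n ^ 4 * ((n : ℝ) + 1) ^ (6 * (k n + 1)) *
      (d : ℝ) ^ (16 * (k n + 1)) / (d : ℝ) ^ n) := by
    have := hB n
    rw [Real.log_div (by positivity) (by positivity), Real.log_mul (by positivity) (by positivity),
      Real.log_mul (by positivity) (by positivity)]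
    simp only [Real.log_pow]
    push_cast
    ring
  have := hB n
  rw [Function.comp_apply, e, Real.exp_log (by positivity)]

/-- States with an advantage over separable states have a small reduced state far from
maximally mixed. -/
theorem exists_le_norm_traceDev_of_lt {d n : ℕ} (hd : 0 < d) {k : ℕ} {B c : ℝ} (hB : 0 < B)
    (hc : 0 < c) {ψ : NQudit d n}
    (hψ : (c : EReal) < ⨆ H ∈ hamiltonianSet d n k B, ((qfi ψ H - maxSepQFI H : ℝ) : EReal)) :
    ∃ V : Finset (Fin n), V.card ≤ 2 * (k + 1) ∧ ∃ a b,
      c / (12 * (B ^ 2 * (((n : ℝ) + 1) ^ (k + 1) * (d : ℝ) ^ (k + 1)) ^ 2 *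
        (d : ℝ) ^ (4 * (k + 1)))) ≤ ‖traceDev ψ (unitOp V a b)‖ := by
  have hd0 : (0 : ℝ) < d := by exact_mod_cast hd
  by_contra! h
  obtain ⟨H, hH⟩ := lt_iSup_iff.1 hψ
  obtain ⟨hmem, hlt⟩ := lt_iSup_iff.1 hH
  have hlt' : c < qfi ψ H - maxSepQFI H := EReal.coe_lt_coe_iff.1 hlt
  have hle := qfi_sub_maxSepQFI_le_of_mem hd hB.le (by positivity) hmem ψ
    fun V hV a b => (h V hV a b).le
  -- The threshold was chosen so that the deterministic bound is exactly c.
  rw [mul_div_cancel₀ _ (by positivity)] at hle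
  linarith

end Probability

end QuditQFI

end

theorem mainTheorem5 (d : ℕ) (hd : 0 < d) (k : ℕ → ℕ)
    (hk : (fun n => (k n : ℝ)) =o[atTop] fun n : ℕ => (n : ℝ) / Real.log n)
    (B : ℕ → ℝ) (hB : ∀ n, 0 < B n)
    (hBo : (fun n => Real.log (B n)) =o[atTop] fun n : ℕ => (n : ℝ))
    (c : ℝ) (hc : 0 < c) :
    Tendsto
      (fun n : ℕ => QuditQFI.haarState d n
        {ψ | (c : EReal) < ⨆ H ∈ QuditQFI.hamiltonianSet d n (k n) (B n),
          ((QuditQFI.qfi (ψ : QuditQFI.NQudit d n) H - QuditQFI.maxSepQFI H : ℝ) : EReal)})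
      atTop (𝓝 0) := by
  have hd0 : (0 : ℝ) < d := by exact_mod_cast hd
  set ε : ℕ → ℝ := fun n => c / (12 * (B n ^ 2 *
    (((n : ℝ) + 1) ^ (k n + 1) * (d : ℝ) ^ (k n + 1)) ^ 2 * (d : ℝ) ^ (4 * (k n + 1)))) with hε
  have hε0 : ∀ n, 0 < ε n := fun n => by
    have := hB n
    positivity
  rcases Nat.lt_or_ge 1 d with hd2 | hd1
  · have hlim := ((QuditQFI.tendsto_exponential_decay hd2 hk hB hBo).const_mul
      (144 / c ^ 2))
    rw [mul_zero] at hlim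
    have hlim' := ENNReal.tendsto_ofReal hlim
    rw [ENNReal.ofReal_zero] at hlim'
    refine tendsto_of_tendsto_of_tendsto_of_le_of_le tendsto_const_nhds hlim'
      (fun _ => zero_le) fun n => ?_
    have : IsProbabilityMeasure (QuditQFI.haarState d n) :=
      QuditQFI.isProbabilityMeasure_haarState hd
    have hb := QuditQFI.haarState_exists_le_norm_traceDev hd n (k n + 1) (hε0 n)
    rw [← ENNReal.ofReal_toReal (measure_ne_top _ _)]
    -- Monotonicity suffices, so measurability of the event with the supremum is never needed. Since
    -- ε⁻² contributes (n+1)^(4(k+1)) and d^(12(k+1)), the exponents become 6 and 16.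
    refine ENNReal.ofReal_le_ofReal (((measureReal_mono fun ψ hψ =>
      QuditQFI.exists_le_norm_traceDev_of_lt hd (hB n) hc hψ).trans hb).trans (le_of_eq ?_))
    have := hB n
    simp only [hε]
    field_simp
    ring
  -- For d = 1 there is no exponential decay, but the space is one-dimensional, all deviations
  -- vanish and the event is empty.
  · obtain rfl : d = 1 := le_antisymm hd1 hd
    refine tendsto_const_nhds.congr fun n => ?_
    symm
    refine measure_mono_null (t := ∅) (Set.subset_empty_iff.2 ?_) measure_empty
    refine Set.eq_empty_of_forall_notMem fun ψ hψ => ?_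
    obtain ⟨V, -, a, b, h⟩ := QuditQFI.exists_le_norm_traceDev_of_lt hd (hB n) hc hψ
    rw [QuditQFI.traceDev_eq_zero_of_unique, norm_zero] at h
    exact (hε0 n).not_ge h
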